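/- Setting. A system with $m$ inputs and $p$ outputs is a linear, shift-invariant behavior $\mathcal B\subseteq(\mathbb R^{m+p})^{\mathbb N_0}$ that is closed under pointwise convergence and that is the set of all trajectories $(u,y)$ of some state space representation $x(t+1)=Ax(t)+Bu(t)$, $y(t)=Cx(t)+Du(t)$ of finite state dimension $n$. Its impulse response is $D,CB,CAB,CA^2B,\dots$; its lag $l(\mathcal B)$ is the least $L\ge 0$ such that the matrix with block rows $C,CA,\dots,CA^{L-1}$ of a representation of minimal state dimension $n$ has rank $n$. The induced SISO system $\mathcal B^{i,j}$ consists of all $(u_j,y_i)$ with $(u,y)\in\mathcal B$ and $u_k=0$ for all $k\ne j$. Its relative degree $r_{ij}(\mathcal B)\in\mathbb N_0\cup\{\infty\}$ is the index (starting with $0$) of the first non-zero value of its impulse response ($\infty$ if there is none). The system $\mathcal B$ has vector relative degree $r\in\mathbb N_0^p$ if $D_i=0$ whenever $r_i>0$, $C_iA^kB=0$ for $0\le k\le r_i-2$, and the matrix with rows $G_i=D_i$ (if $r_i=0$), $G_i=C_iA^{r_i-1}B$ (if $r_i>0$) has rank $p$. The decoupling matrix of $\mathcal B$ is the matrix with these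 rows formed for $r_i=\min_j r_{ij}(\mathcal B)$, provided that these minima are finite (no rank condition is imposed). Let $\Lambda\subseteq\mathbb N_0$ be the set of a priori admissible lags ($\Lambda=\{l\}$ if the lag is known to be $l$; $\Lambda=\mathbb N_0$ if nothing is known), and let $\Sigma$ be the class of all systems with $m$ inputs and $p$ outputs whose lag lies in $\Lambda$. For a data sequence $\mathcal D=(u_d(t),y_d(t))_{0\le t\le T}$ let $\Sigma_{\mathcal D}$ be the set of all systems in $\Sigma$ having a trajectory that restricts to $\mathcal D$ on $[0,T]$. The data are informative for a property if every system in $\Sigma_{\mathcal D}$ has it. Statement. Let $\mathcal B\in\Sigma_{\mathcal D}$. Let $A_{\mathcal D}$ be the set of pairs $(i,j)$, $1\le i\le p$, $1\le j\le m$, such that for some $r\in\mathbb N_0$ the data are informative for the relative degree of the induced SISO system with indices $(i,j)$ being $r$; write $r_{ij}=r_{ij}(\mathcal B)$ for $(i,j)\in A_{\mathcal D}$. Assume that for every $i$ there is $j$ with $(i,j)\in A_{\mathcal D}$, and put $r_i=\min_{(i,k)\in A_{\mathcal D}}r_{ik}$. Assume moreover that $r_{ij}(\tilde{\mathcal B})\ge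 r_i+1$ for all $(i,j)\notin A_{\mathcal D}$ and all $\tilde{\mathcal B}\in\Sigma_{\mathcal D}$. Then: (1) There is exactly one matrix $G\in\mathbb R^{p\times m}$ such that, for every $(i,j)\in A_{\mathcal D}$ with $r_{ij}=r_i$, the data are informative for $G_{ij}$ being the first non-zero value of the impulse response of the induced SISO system with indices $(i,j)$, and $G_{ij}=0$ for all other $(i,j)$. (2) The data are informative for the system having decoupling matrix $G$. (3) If $\mathcal B$ has a vector relative degree, then the data are informative for the vector relative degree $(r_1,\dots,r_p)$. -/

import Mathlib

open scoped Matrix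

namespace DataInformativity

/-- A value of the signal: `m` input coordinates followed by `p` output coordinates. -/
abbrev Signal (m p : ℕ) := (Fin m → ℝ) × (Fin p → ℝ)

/-- Linear behaviors over the time axis `ℕ = {0, 1, 2, …}`: linear subspaces of the space of all
trajectories. The trajectory space carries the topology of pointwise convergence. -/
abbrev Behavior (m p : ℕ) := Submodule ℝ (ℕ → Signal m p)

/-- The (linear) behavior is time-invariant and complete. -/
def IsLTIComplete {m p : ℕ} (𝔅 : Behavior m p) : Prop :=
  (∀ w ∈ 𝔅, (fun t => w (t + 1)) ∈ 𝔅) ∧ IsClosed (𝔅 : Set (ℕ → Signal m p))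

/-- Input/state/output systems `x(t+1) = A x(t) + B u(t)`, `y(t) = C x(t) + D u(t)`. -/
structure StateSpace (n m p : ℕ) where
  A : Matrix (Fin n) (Fin n) ℝ
  B : Matrix (Fin n) (Fin m) ℝ
  C : Matrix (Fin p) (Fin n) ℝ
  D : Matrix (Fin p) (Fin m) ℝ

namespace StateSpace

variable {n m p : ℕ}

/-- The input/output trajectories of a state space system, for all initial states. -/
def behavior (S : StateSpace n m p) : Behavior m p where
  carrier := {w | ∃ x : ℕ → Fin n → ℝ, ∀ t,
    x (t + 1) = S.A *ᵥ x t + S.B *ᵥ (w t).1 ∧ (w t).2 = S.C *ᵥ x t + S.D *ᵥ (w t).1}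
  zero_mem' := ⟨0, fun t => by simp⟩
  add_mem' := by
    rintro w w' ⟨x, hx⟩ ⟨x', hx'⟩
    refine ⟨x + x', fun t => ⟨?_, ?_⟩⟩
    · simp only [Pi.add_apply, Prod.fst_add, Matrix.mulVec_add, (hx t).1, (hx' t).1]
      abel
    · simp only [Pi.add_apply, Prod.fst_add, Prod.snd_add, Matrix.mulVec_add, (hx t).2, (hx' t).2]
      abel
  smul_mem' := by
    rintro c w ⟨x, hx⟩
    refine ⟨c • x, fun t => ⟨?_, ?_⟩⟩
    · simp only [Pi.smul_apply, Prod.smul_fst, Matrix.mulVec_smul, (hx t).1, smul_add]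
    · simp only [Pi.smul_apply, Prod.smul_fst, Prod.smul_snd, Matrix.mulVec_smul, (hx t).2,
        smul_add]

/-- No representation of the same behavior has a smaller state space. -/
def IsMinimal (S : StateSpace n m p) : Prop :=
  ∀ (n' : ℕ) (S' : StateSpace n' m p), S'.behavior = S.behavior → n ≤ n'

/-- The truncated observability matrix with block rows `C, CA, …, CA^(L-1)`. -/
def obsMatrix (S : StateSpace n m p) (L : ℕ) : Matrix (Fin L × Fin p) (Fin n) ℝ :=
  Matrix.of fun a j => (S.C * S.A ^ (a.1 : ℕ)) a.2 j

/-- The impulse response `D, CB, CAB, CA²B, …`. -/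
def impulseResponse (S : StateSpace n m p) : ℕ → Matrix (Fin p) (Fin m) ℝ
  | 0 => S.D
  | k + 1 => S.C * S.A ^ k * S.B

/-- The relative degree of a SISO representation: the index of the first non-zero entry of the
impulse response, and `⊤` if the impulse response vanishes. -/
noncomputable def relativeDegree (S : StateSpace n 1 1) : ℕ∞ :=
  ⨅ (k : ℕ) (_ : S.impulseResponse k 0 0 ≠ 0), (k : ℕ∞)

/-- The matrix with `i`-th row `D_i` if `r i = 0` and `C_i A^(r i - 1) B` if `r i > 0`. -/
def decouplingMatrix (S : StateSpace n m p) (r : Fin p → ℕ) : Matrix (Fin p) (Fin m) ℝ :=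
  Matrix.of fun i => if r i = 0 then S.D i else (S.C * S.A ^ (r i - 1) * S.B) i

/-- The state trajectory with initial state zero of a state space system. -/
def forced (S : StateSpace n m p) (u : ℕ → Fin m → ℝ) : ℕ → Fin n → ℝ
  | 0 => 0
  | t + 1 => S.A *ᵥ forced S u t + S.B *ᵥ u t

theorem forced_succ (S : StateSpace n m p) (u : ℕ → Fin m → ℝ) (t : ℕ) :
    S.forced u (t + 1) = S.A *ᵥ S.forced u t + S.B *ᵥ u t := rfl

theorem continuous_forced (S : StateSpace n m p) (t : ℕ) :
    Continuous fun w : ℕ → Signal m p => S.forced (fun s => (w s).1) t := by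
  induction t with
  | zero => exact continuous_const
  | succ t ih =>
    simp only [forced_succ]
    have h : Continuous fun w : ℕ → Signal m p => (w t).1 := by fun_prop
    exact (continuous_const.matrix_mulVec ih).add (continuous_const.matrix_mulVec h)

/-- State space systems define linear, time-invariant, complete behaviors. -/
theorem isLTIComplete_behavior (S : StateSpace n m p) : IsLTIComplete S.behavior := by
  constructor
  · rintro w ⟨x, hx⟩
    exact ⟨fun t => x (t + 1), fun t => hx (t + 1)⟩
  · let O : (Fin n → ℝ) →ₗ[ℝ] (ℕ → Fin p → ℝ) :=
      LinearMap.pi fun t => (S.C * S.A ^ t).mulVecLin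
    have hO : ∀ x t, O x t = (S.C * S.A ^ t) *ᵥ x := fun x t => rfl
    let Ψ : (ℕ → Signal m p) → (ℕ → Fin p → ℝ) := fun w t =>
      (w t).2 - (S.C *ᵥ S.forced (fun s => (w s).1) t + S.D *ᵥ (w t).1)
    have hΨ : Continuous Ψ := by
      refine continuous_pi fun t => ?_
      have h1 : Continuous fun w : ℕ → Signal m p => (w t).1 := by fun_prop
      have h2 : Continuous fun w : ℕ → Signal m p => (w t).2 := by fun_prop
      exact h2.sub ((continuous_const.matrix_mulVec (S.continuous_forced t)).add
        (continuous_const.matrix_mulVec h1))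
    have hcl : IsClosed ((LinearMap.range O : Submodule ℝ (ℕ → Fin p → ℝ)) :
        Set (ℕ → Fin p → ℝ)) := Submodule.closed_of_finiteDimensional _
    convert hcl.preimage hΨ using 1
    ext w
    constructor
    · rintro ⟨x, hx⟩
      have key : ∀ t, x t = S.A ^ t *ᵥ x 0 + S.forced (fun s => (w s).1) t := by
        intro t
        induction t with
        | zero => simp [forced]
        | succ t ih =>
          rw [(hx t).1, ih, forced_succ, Matrix.mulVec_add, Matrix.mulVec_mulVec, pow_succ', add_assoc]
      refine ⟨x 0, ?_⟩
      funext t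
      rw [hO]
      simp only [Ψ]
      rw [(hx t).2, key t, Matrix.mulVec_add, Matrix.mulVec_mulVec]
      abel
    · rintro ⟨x0, h0⟩
      refine ⟨fun t => S.A ^ t *ᵥ x0 + S.forced (fun s => (w s).1) t, fun t => ⟨?_, ?_⟩⟩
      · beta_reduce
        rw [forced_succ, Matrix.mulVec_add, Matrix.mulVec_mulVec, pow_succ', add_assoc]
      · have h := congrFun h0 t
        rw [hO] at h
        simp only [Ψ] at h
        beta_reduce
        rw [Matrix.mulVec_add, Matrix.mulVec_mulVec, h]
        abel

end StateSpace

variable {m p : ℕ}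

/-- Linear, time-invariant, complete systems for which the first `m` coordinates are the inputs and
the last `p` coordinates are the outputs, i.e. which have an input/state/output representation with
respect to this partition of the coordinates. -/
def systems (m p : ℕ) : Set (Behavior m p) :=
  {𝔅 | IsLTIComplete 𝔅 ∧ ∃ (n : ℕ) (S : StateSpace n m p), S.behavior = 𝔅}

/-- The lag: the smallest `L` for which the truncated observability matrix of a minimal
representation has full column rank. -/
noncomputable def lag (𝔅 : Behavior m p) : ℕ :=
  sInf {L | ∃ (n : ℕ) (S : StateSpace n m p),
    S.behavior = 𝔅 ∧ S.IsMinimal ∧ (S.obsMatrix L).rank = n}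

/-- The model class of all systems with `m` inputs and `p` outputs whose lag belongs to the set `Λ`.
The set `Λ` is the prior knowledge about the lag: `Λ = {l}` if the lag is known to be `l`,
and `Λ = Set.univ` if nothing is known. -/
def modelClass (m p : ℕ) (Λ : Set ℕ) : Set (Behavior m p) :=
  {𝔅 ∈ systems m p | lag 𝔅 ∈ Λ}

/-- The finite data sequence `d(0), …, d(T)` is the restriction of a trajectory of `𝔅`. -/
def Explains {T : ℕ} (𝔅 : Behavior m p) (d : Fin (T + 1) → Signal m p) : Prop :=
  ∃ w ∈ 𝔅, ∀ t : Fin (T + 1), w t = d t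

/-- All systems of the model class `𝓜` that explain the data. -/
def explaining {T : ℕ} (𝓜 : Set (Behavior m p)) (d : Fin (T + 1) → Signal m p) :
    Set (Behavior m p) :=
  {𝔅 ∈ 𝓜 | Explains 𝔅 d}

/-- The data are informative for the property `P` (within the model class `𝓜`). -/
def Informative {T : ℕ} (𝓜 : Set (Behavior m p)) (d : Fin (T + 1) → Signal m p)
    (P : Behavior m p → Prop) : Prop :=
  explaining 𝓜 d ⊆ {𝔅 ∈ 𝓜 | P 𝔅}

/-- The induced SISO system from input `j` to output `i`: all other inputs are zero. -/
def inducedSISO (𝔅 : Behavior m p) (i : Fin p) (j : Fin m) : Behavior 1 1 where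
  carrier := {w | ∃ v ∈ 𝔅, ∀ t,
    (w t).1 0 = (v t).1 j ∧ (w t).2 0 = (v t).2 i ∧ ∀ k, k ≠ j → (v t).1 k = 0}
  zero_mem' := ⟨0, 𝔅.zero_mem, fun t => by simp⟩
  add_mem' := by
    rintro w w' ⟨v, hv, h⟩ ⟨v', hv', h'⟩
    refine ⟨v + v', 𝔅.add_mem hv hv', fun t => ⟨?_, ?_, fun k hk => ?_⟩⟩
    · simp [(h t).1, (h' t).1]
    · simp [(h t).2.1, (h' t).2.1]
    · simp [(h t).2.2 k hk, (h' t).2.2 k hk]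
  smul_mem' := by
    rintro c w ⟨v, hv, h⟩
    refine ⟨c • v, 𝔅.smul_mem c hv, fun t => ⟨?_, ?_, fun k hk => ?_⟩⟩
    · simp [(h t).1]
    · simp [(h t).2.1]
    · simp [(h t).2.2 k hk]

/-- The relative degree of a SISO system is that of an arbitrary state space representation (all of
them have the same impulse response). -/
noncomputable def relativeDegree (𝔅 : Behavior 1 1) : ℕ∞ :=
  sInf {r | ∃ (n : ℕ) (S : StateSpace n 1 1), S.behavior = 𝔅 ∧ S.relativeDegree = r}

/-- `a` is the first non-zero value of the impulse response of the SISO system. -/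
def HasLeadingValue (𝔅 : Behavior 1 1) (a : ℝ) : Prop :=
  ∃ (n : ℕ) (S : StateSpace n 1 1), S.behavior = 𝔅 ∧
    ∃ k : ℕ, (∀ l < k, S.impulseResponse l 0 0 = 0) ∧ S.impulseResponse k 0 0 = a ∧ a ≠ 0

/-- The system has vector relative degree `r`. -/
def HasVectorRelativeDegree (𝔅 : Behavior m p) (r : Fin p → ℕ) : Prop :=
  ∃ (n : ℕ) (S : StateSpace n m p), S.behavior = 𝔅 ∧
    (∀ i, (∀ k, k + 2 ≤ r i → (S.C * S.A ^ k * S.B) i = 0) ∧ (0 < r i → S.D i = 0)) ∧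
    (S.decouplingMatrix r).rank = p

/-- `G` is the decoupling matrix of the system, formed with the only candidate for the vector
relative degree, namely the row-wise minima of the relative degrees of the induced SISO systems
(which have to be finite). No rank condition is imposed on `G`. -/
def HasDecouplingMatrix (𝔅 : Behavior m p) (G : Matrix (Fin p) (Fin m) ℝ) : Prop :=
  ∃ (n : ℕ) (S : StateSpace n m p), S.behavior = 𝔅 ∧
    ∃ r : Fin p → ℕ, (∀ i, (r i : ℕ∞) = ⨅ j, relativeDegree (inducedSISO 𝔅 i j)) ∧
      G = S.decouplingMatrix r

/-- The pairs `(i, j)` for which the data are informative for the (finite) relative degree of the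
induced SISO system from input `j` to output `i`. -/
def informativePairs {T : ℕ} (𝓜 : Set (Behavior m p)) (d : Fin (T + 1) → Signal m p) :
    Set (Fin p × Fin m) :=
  {q | ∃ r : ℕ, Informative 𝓜 d fun 𝔅 => relativeDegree (inducedSISO 𝔅 q.1 q.2) = r}

/-- The minimum of the relative degrees `r_ij` of the system `𝔅` over the informative pairs in the
row `i`. -/
noncomputable def rowMin {T : ℕ} (𝓜 : Set (Behavior m p)) (d : Fin (T + 1) → Signal m p)
    (𝔅 : Behavior m p) (i : Fin p) : ℕ :=
  sInf {r : ℕ | ∃ j, (i, j) ∈ informativePairs 𝓜 d ∧ relativeDegree (inducedSISO 𝔅 i j) = r}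

/-- `G` is the matrix built from the data: for an informative pair that attains the minimum of its
row, `G i j` is the value identified by the data as the first non-zero value of the impulse
response of the induced SISO system; all other entries are zero. -/
def IsIdentifiedMatrix {T : ℕ} (𝓜 : Set (Behavior m p)) (d : Fin (T + 1) → Signal m p)
    (𝔅 : Behavior m p) (G : Matrix (Fin p) (Fin m) ℝ) : Prop :=
  ∀ i j,
    ((i, j) ∈ informativePairs 𝓜 d ∧
        relativeDegree (inducedSISO 𝔅 i j) = (rowMin 𝓜 d 𝔅 i : ℕ∞) →
      Informative 𝓜 d fun 𝔅' => HasLeadingValue (inducedSISO 𝔅' i j) (G i j)) ∧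
    (¬ ((i, j) ∈ informativePairs 𝓜 d ∧
        relativeDegree (inducedSISO 𝔅 i j) = (rowMin 𝓜 d 𝔅 i : ℕ∞)) →
      G i j = 0)

end DataInformativity

/-! The data fix everything that enters the decoupling matrix; the reason is a perturbation
argument. A system of lag at most `L` is contained in an ARX model of order `L` with the same
impulse response, and for `p > 0` such a model has lag exactly `L`. Two explaining systems can
therefore be enlarged to ARX models `θ`, `θ'` of common order `L`, the larger of their lags. Since
`L ∈ Λ`, both models are again admissible and explain the data.

On the data, row `i'` of `θ` and row `i'` of `θ'` predict the same output, so any multiple `c` of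
their difference may be added to row `i` of `θ`. If the impulse responses agree before index `k` in
column `j`, this changes entry `(i, j)` at index `k` from `a` to `a + cδ`, where `δ` is the
discrepancy of the two systems at `(i', j)`. If the relative degree at `(i, j)` is known to be `r`,
then `a + cδ` vanishes for all `c` when `k < r` and for no `c` when `k = r`; either way `δ = 0`. By
induction, the whole column `j` is determined up to index `r` (`impulseResponse_eq_of_informative`).

Row `i` of the decoupling matrix consists of the entries at index `r_i`. They are determined for
informative pairs since `r_i ≤ r_ij`, and they are zero for the others by the lower bound `r_i + 1`.
All explaining systems thus share the matrix, and with it the rank condition for the vector relative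
degree. -/

namespace DataInformativity

open Module

variable {n m p : ℕ}

/-! ### State space representations, observability and the lag -/

/-- A linear system with an arbitrary finite-dimensional state space has a matrix representation. -/
theorem exists_stateSpace_of_linearMap {V : Type*} [AddCommGroup V] [Module ℝ V]
    [FiniteDimensional ℝ V] (A : V →ₗ[ℝ] V) (B : (Fin m → ℝ) →ₗ[ℝ] V)
    (C : V →ₗ[ℝ] (Fin p → ℝ)) (D : (Fin m → ℝ) →ₗ[ℝ] (Fin p → ℝ)) :
    ∃ S : StateSpace (finrank ℝ V) m p, ∀ w : ℕ → Signal m p, w ∈ S.behavior ↔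
      ∃ x : ℕ → V, ∀ t, x (t + 1) = A (x t) + B (w t).1 ∧ (w t).2 = C (x t) + D (w t).1 := by
  let e : V ≃ₗ[ℝ] (Fin (finrank ℝ V) → ℝ) := (finBasis ℝ V).equivFun
  refine ⟨⟨LinearMap.toMatrix' (e.toLinearMap ∘ₗ A ∘ₗ e.symm.toLinearMap),
    LinearMap.toMatrix' (e.toLinearMap ∘ₗ B), LinearMap.toMatrix' (C ∘ₗ e.symm.toLinearMap),
    LinearMap.toMatrix' D⟩, fun w => ⟨?_, ?_⟩⟩
  · rintro ⟨x, hx⟩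
    refine ⟨fun t => e.symm (x t), fun t => ⟨?_, ?_⟩⟩
    · have h := (hx t).1
      simp only [LinearMap.toMatrix'_mulVec] at h
      apply e.injective
      simpa using h
    · have h := (hx t).2
      simp only [LinearMap.toMatrix'_mulVec] at h
      simpa using h
  · rintro ⟨x, hx⟩
    refine ⟨fun t => e (x t), fun t => ⟨?_, ?_⟩⟩
    · simp only [LinearMap.toMatrix'_mulVec]
      simp [(hx t).1]
    · simp only [LinearMap.toMatrix'_mulVec]
      simp [(hx t).2]

namespace StateSpace

theorem pow_succ_mulVec (S : StateSpace n m p) (t : ℕ) (x : Fin n → ℝ) :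
    (S.C * S.A ^ (t + 1)) *ᵥ x = (S.C * S.A ^ t) *ᵥ (S.A *ᵥ x) := by
  rw [Matrix.mulVec_mulVec, pow_succ, Matrix.mul_assoc]

/-- The unobservable subspace. -/
def unobservable (S : StateSpace n m p) : Submodule ℝ (Fin n → ℝ) :=
  ⨅ t : ℕ, LinearMap.ker (S.C * S.A ^ t).mulVecLin

theorem mem_unobservable (S : StateSpace n m p) (x : Fin n → ℝ) :
    x ∈ S.unobservable ↔ ∀ t : ℕ, (S.C * S.A ^ t) *ᵥ x = 0 := by
  simp [unobservable, Submodule.mem_iInf]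

/-- Minimal representations are observable. -/
theorem IsMinimal.unobservable_eq_bot {S : StateSpace n m p} (hS : S.IsMinimal) :
    S.unobservable = ⊥ := by
  set N := S.unobservable with hN
  have hA : N ≤ N.comap S.A.mulVecLin := by
    intro x hx
    rw [Submodule.mem_comap, hN, mem_unobservable]
    intro t
    have := (S.mem_unobservable x).1 hx (t + 1)
    rwa [pow_succ_mulVec] at this
  have hC : N ≤ LinearMap.ker S.C.mulVecLin := by
    intro x hx
    have := (S.mem_unobservable x).1 hx 0
    simpa using this
  -- Dividing the state space by the unobservable subspace keeps the behavior, so minimality forces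
  -- that subspace to have dimension zero.
  obtain ⟨S', hS'⟩ := exists_stateSpace_of_linearMap (N.mapQ N S.A.mulVecLin hA)
    (N.mkQ ∘ₗ S.B.mulVecLin) (N.liftQ S.C.mulVecLin hC) S.D.mulVecLin
  have hle := hS _ S' ?_
  · have h := N.finrank_quotient_add_finrank
    rw [finrank_fin_fun] at h
    exact Submodule.finrank_eq_zero.1 (by omega)
  · ext w
    rw [hS']
    constructor
    · rintro ⟨x, hx⟩
      obtain ⟨x0, hx0⟩ := N.mkQ_surjective (x 0)
      -- A trajectory of the quotient is lifted by lifting only its initial state and running the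
      -- original dynamics.
      let z : ℕ → Fin n → ℝ := fun t => Nat.rec x0 (fun t v => S.A *ᵥ v + S.B *ᵥ (w t).1) t
      have hz : ∀ t, x t = N.mkQ (z t) := by
        intro t
        induction t with
        | zero => exact hx0.symm
        | succ t ih =>
          rw [(hx t).1, ih]
          simp [z]
      refine ⟨z, fun t => ⟨rfl, ?_⟩⟩
      rw [(hx t).2, hz t]
      simp
    · rintro ⟨x, hx⟩
      refine ⟨fun t => N.mkQ (x t), fun t => ⟨?_, ?_⟩⟩
      · beta_reduce
        rw [(hx t).1]
        simp
      · rw [(hx t).2]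
        simp

/-- Cayley–Hamilton: `A ^ t` is the value at `A` of the remainder of `X ^ t` modulo the
characteristic polynomial, which has degree below `n`. -/
theorem mulVec_eq_zero_of_forall_lt (S : StateSpace n m p) {x : Fin n → ℝ}
    (hx : ∀ t < n, (S.C * S.A ^ t) *ᵥ x = 0) (t : ℕ) : (S.C * S.A ^ t) *ᵥ x = 0 := by
  rw [Matrix.pow_eq_aeval_mod_charpoly, Polynomial.aeval_eq_sum_range, Matrix.mul_sum,
    Matrix.sum_mulVec]
  refine Finset.sum_eq_zero fun k hk => ?_
  rw [Matrix.mul_smul, Matrix.smul_mulVec]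
  rcases Nat.lt_or_ge k n with h | h
  · rw [hx k h, smul_zero]
  · rw [Polynomial.coeff_eq_zero_of_degree_lt, zero_smul]
    refine (Polynomial.degree_modByMonic_lt _ S.A.charpoly_monic).trans_le ?_
    rw [Matrix.charpoly_degree_eq_dim]
    simpa using h

theorem obsMatrix_mulVec (S : StateSpace n m p) (L : ℕ) (x : Fin n → ℝ) (a : Fin L × Fin p) :
    (S.obsMatrix L *ᵥ x) a = ((S.C * S.A ^ (a.1 : ℕ)) *ᵥ x) a.2 := rfl

theorem rank_obsMatrix_eq_iff (S : StateSpace n m p) (L : ℕ) :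
    (S.obsMatrix L).rank = n ↔ ∀ x, (∀ t < L, (S.C * S.A ^ t) *ᵥ x = 0) → x = 0 := by
  have hker : ∀ x, x ∈ LinearMap.ker (S.obsMatrix L).mulVecLin ↔
      ∀ t < L, (S.C * S.A ^ t) *ᵥ x = 0 := by
    intro x
    rw [LinearMap.mem_ker, Matrix.mulVecLin_apply]
    constructor
    · intro h t ht
      ext i
      exact congrFun h (⟨t, ht⟩, i)
    · intro h
      ext a
      rw [obsMatrix_mulVec, h a.1 a.1.2]
      rfl
  have hrk := (S.obsMatrix L).mulVecLin.finrank_range_add_finrank_ker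
  rw [finrank_fin_fun] at hrk
  change (S.obsMatrix L).rank + _ = n at hrk
  have : (S.obsMatrix L).rank = n ↔ LinearMap.ker (S.obsMatrix L).mulVecLin = ⊥ := by
    rw [← Submodule.finrank_eq_zero]
    omega
  rw [this, Submodule.eq_bot_iff]
  simp only [hker]

theorem IsMinimal.rank_obsMatrix {S : StateSpace n m p} (hS : S.IsMinimal) :
    (S.obsMatrix n).rank = n := by
  rw [rank_obsMatrix_eq_iff]
  intro x hx
  have : x ∈ S.unobservable := (S.mem_unobservable x).2 (S.mulVec_eq_zero_of_forall_lt hx)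
  rwa [hS.unobservable_eq_bot] at this

theorem exists_isMinimal (S : StateSpace n m p) :
    ∃ (n' : ℕ) (S' : StateSpace n' m p), S'.behavior = S.behavior ∧ S'.IsMinimal := by
  classical
  have hex : ∃ k, ∃ S' : StateSpace k m p, S'.behavior = S.behavior := ⟨n, S, rfl⟩
  obtain ⟨S', hS'⟩ := Nat.find_spec hex
  exact ⟨_, S', hS', fun k S'' h => Nat.find_min' hex ⟨S'', h.trans hS'⟩⟩

end StateSpace

/-- The lag is attained by some minimal representation. -/
theorem exists_isMinimal_rank_obsMatrix_lag {𝔅 : Behavior m p} (h : 𝔅 ∈ systems m p) :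
    ∃ (n : ℕ) (S : StateSpace n m p),
      S.behavior = 𝔅 ∧ S.IsMinimal ∧ (S.obsMatrix (lag 𝔅)).rank = n := by
  obtain ⟨-, n, S, rfl⟩ := h
  obtain ⟨n', S', hS', hmin⟩ := S.exists_isMinimal
  exact Nat.sInf_mem (s := {L | ∃ (n : ℕ) (S₁ : StateSpace n m p),
    S₁.behavior = S.behavior ∧ S₁.IsMinimal ∧ (S₁.obsMatrix L).rank = n})
    ⟨n', n', S', hS', hmin, hmin.rank_obsMatrix⟩

/-! ### ARX models: continuation of finite sequences and realization -/

/-- The coefficients of one scalar autoregressive equation with exogenous input: first those of the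
past outputs, then those of the inputs. -/
abbrev ARXRow (m p : ℕ) := (ℕ → Fin p → ℝ) × (ℕ → Fin m → ℝ)

/-- The right-hand side `∑_{a < L} f_a y(t+a) + ∑_{a ≤ L} q_a u(t+a)` of an autoregressive
equation of order `L`. -/
def ARXRow.eval (L : ℕ) (ρ : ARXRow m p) (w : ℕ → Signal m p) (t : ℕ) : ℝ :=
  ∑ a ∈ Finset.range L, ρ.1 a ⬝ᵥ (w (t + a)).2 +
    ∑ a ∈ Finset.range (L + 1), ρ.2 a ⬝ᵥ (w (t + a)).1

namespace ARXRow

theorem eval_add (L : ℕ) (ρ σ : ARXRow m p) (w : ℕ → Signal m p) (t : ℕ) :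
    eval L (ρ + σ) w t = eval L ρ w t + eval L σ w t := by
  simp only [eval, Prod.fst_add, Prod.snd_add, Pi.add_apply, add_dotProduct,
    Finset.sum_add_distrib]
  ring

theorem eval_smul (L : ℕ) (c : ℝ) (ρ : ARXRow m p) (w : ℕ → Signal m p) (t : ℕ) :
    eval L (c • ρ) w t = c * eval L ρ w t := by
  simp only [eval, Prod.smul_fst, Prod.smul_snd, Pi.smul_apply, smul_dotProduct,
    smul_eq_mul, Finset.mul_sum, mul_add]

theorem eval_sub (L : ℕ) (ρ σ : ARXRow m p) (w : ℕ → Signal m p) (t : ℕ) :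
    eval L (ρ - σ) w t = eval L ρ w t - eval L σ w t := by
  have h := eval_add L (ρ - σ) σ w t
  rw [sub_add_cancel] at h
  linarith

theorem eval_congr {L : ℕ} (ρ : ARXRow m p) {w w' : ℕ → Signal m p} {t : ℕ}
    (hy : ∀ a < L, (w (t + a)).2 = (w' (t + a)).2) (hu : ∀ a ≤ L, (w (t + a)).1 = (w' (t + a)).1) :
    eval L ρ w t = eval L ρ w' t := by
  unfold eval
  congr 1
  · exact Finset.sum_congr rfl fun a ha => by rw [hy a (Finset.mem_range.1 ha)]
  · exact Finset.sum_congr rfl fun a ha => by rw [hu a (Nat.lt_succ_iff.1 (Finset.mem_range.1 ha))]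

theorem eval_traj_add (L : ℕ) (ρ : ARXRow m p) (w w' : ℕ → Signal m p) (t : ℕ) :
    eval L ρ (w + w') t = eval L ρ w t + eval L ρ w' t := by
  simp only [eval, Prod.fst_add, Prod.snd_add, Pi.add_apply, dotProduct_add,
    Finset.sum_add_distrib]
  ring

theorem eval_traj_smul (L : ℕ) (c : ℝ) (ρ : ARXRow m p) (w : ℕ → Signal m p) (t : ℕ) :
    eval L ρ (c • w) t = c * eval L ρ w t := by
  simp only [eval, Prod.smul_fst, Prod.smul_snd, Pi.smul_apply, dotProduct_smul,
    smul_eq_mul, Finset.mul_sum, mul_add]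

end ARXRow

/-- The behavior of the autoregressive model of order `L` with exogenous inputs:
`y_i(t+L) = ∑_{a < L} f_{i,a} y(t+a) + ∑_{a ≤ L} q_{i,a} u(t+a)` for all `i`. -/
def arxBehavior (L : ℕ) (θ : Fin p → ARXRow m p) : Behavior m p where
  carrier := {w | ∀ t i, (w (t + L)).2 i = (θ i).eval L w t}
  zero_mem' := fun t i => by simp [ARXRow.eval]
  add_mem' := by
    intro w w' hw hw' t i
    rw [ARXRow.eval_traj_add, ← hw, ← hw']
    rfl
  smul_mem' := by
    intro c w hw t i
    rw [ARXRow.eval_traj_smul, ← hw]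
    rfl

theorem mem_arxBehavior {L : ℕ} {θ : Fin p → ARXRow m p} {w : ℕ → Signal m p} :
    w ∈ arxBehavior L θ ↔ ∀ t i, (w (t + L)).2 i = (θ i).eval L w t := Iff.rfl

/-- The continuation of a finite output sequence to a solution of an autoregressive equation. -/
noncomputable def arxOutput (N L : ℕ) (θ : Fin p → ARXRow m p) (w : ℕ → Signal m p) (t : ℕ) :
    Fin p → ℝ :=
  -- The values before time `L` have no equation and are copied even if `N < L`. The sum below runs
  -- over `Fin L` to give the termination proof the bound on `a`.
  if _h : t < N ∨ t < L then (w t).2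
  else fun i => ∑ a : Fin L, (θ i).1 a ⬝ᵥ arxOutput N L θ w (t - L + a) +
    ∑ a ∈ Finset.range (L + 1), (θ i).2 a ⬝ᵥ (w (t - L + a)).1
termination_by t
decreasing_by omega

/-- A finite sequence that satisfies the autoregressive equations is the restriction of a
trajectory with prescribed future input. -/
theorem exists_mem_arxBehavior (N L : ℕ) (θ : Fin p → ARXRow m p) (w : ℕ → Signal m p)
    (hw : ∀ t i, t + L < N → (w (t + L)).2 i = (θ i).eval L w t) :
    ∃ v ∈ arxBehavior L θ, (∀ t, (v t).1 = (w t).1) ∧ ∀ t, t < N ∨ t < L → v t = w t := by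
  have hv : ∀ t, t < N ∨ t < L → arxOutput N L θ w t = (w t).2 := by
    intro t ht
    rw [arxOutput, dif_pos ht]
  refine ⟨fun t => ((w t).1, arxOutput N L θ w t), ?_, fun t => rfl,
    fun t ht => Prod.ext rfl (hv t ht)⟩
  intro t i
  by_cases h : t + L < N
  · change arxOutput N L θ w (t + L) i = _
    rw [hv _ (Or.inl h), hw t i h]
    exact ARXRow.eval_congr _ (fun a ha => (hv _ (Or.inl (by omega))).symm) fun a ha => rfl
  · change arxOutput N L θ w (t + L) i = _
    rw [arxOutput, dif_neg (by omega), Nat.add_sub_cancel, ARXRow.eval, Finset.sum_range,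
      Finset.sum_range]

/-- Autoregressive models with exogenous inputs have a state space representation. -/
theorem exists_stateSpace_arxBehavior (L : ℕ) (θ : Fin p → ARXRow m p) :
    ∃ (n : ℕ) (S : StateSpace n m p), S.behavior = arxBehavior L θ := by
  let F : ℕ → (Fin p → ℝ) →ₗ[ℝ] (Fin p → ℝ) := fun a =>
    (Matrix.of fun i => (θ i).1 a).mulVecLin
  let Q : ℕ → (Fin m → ℝ) →ₗ[ℝ] (Fin p → ℝ) := fun a =>
    (Matrix.of fun i => (θ i).2 a).mulVecLin
  -- Observer canonical form with `L` blocks of size `p`. The default `0` at index `L` closes the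
  -- chain of blocks and also covers `L = 0`.
  let c : ℕ → (Fin L → Fin p → ℝ) →ₗ[ℝ] (Fin p → ℝ) := fun k =>
    if h : k < L then LinearMap.proj ⟨k, h⟩ else 0
  have hc : ∀ k (h : k < L) x, c k x = x ⟨k, h⟩ := fun k h x => by simp [c, h]
  have hcL : ∀ x, c L x = 0 := fun x => by simp [c]
  obtain ⟨S, hS⟩ := exists_stateSpace_of_linearMap (V := Fin L → Fin p → ℝ)
    (LinearMap.pi fun k : Fin L => c (k + 1) + F (L - 1 - k) ∘ₗ c 0)
    (LinearMap.pi fun k : Fin L => F (L - 1 - k) ∘ₗ Q L + Q (L - 1 - k)) (c 0) (Q L)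
  refine ⟨_, S, ?_⟩
  ext w
  rw [hS]
  let g : ℕ → ℕ → Fin p → ℝ := fun a t => F a (w t).2 + Q a (w t).1
  -- The state equations, solved for the blocks in terms of `w` alone. The one remaining condition
  -- `X L = 0` is the ARX equation.
  let X : ℕ → ℕ → Fin p → ℝ := fun k => Nat.rec (fun t => (w t).2 - Q L (w t).1)
    (fun k v t => v (t + 1) - g (L - 1 - k) t) k
  have hX0 : ∀ t, X 0 t = (w t).2 - Q L (w t).1 := fun t => rfl
  have hXs : ∀ k t, X (k + 1) t = X k (t + 1) - g (L - 1 - k) t := fun k t => rfl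
  have hX : ∀ k ≤ L, ∀ t, X k t = (w (t + k)).2 - Q L (w (t + k)).1 -
      ∑ b ∈ Finset.range k, g (L - k + b) (t + b) := by
    intro k
    induction k with
    | zero => intro _ t; simp [hX0]
    | succ k ih =>
      intro hk t
      rw [hXs, ih (by omega), Finset.sum_range_succ']
      have e1 : t + 1 + k = t + (k + 1) := by omega
      have e2 : ∑ b ∈ Finset.range k, g (L - k + b) (t + 1 + b) =
          ∑ b ∈ Finset.range k, g (L - (k + 1) + (b + 1)) (t + (b + 1)) :=
        Finset.sum_congr rfl fun b _ => by congr 1 <;> omega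
      have e3 : L - (k + 1) + 0 = L - 1 - k := by omega
      rw [e1, e2, e3, add_zero]
      abel
  have hXL : w ∈ arxBehavior L θ ↔ ∀ t, X L t = 0 := by
    rw [mem_arxBehavior]
    refine forall_congr' fun t => ?_
    rw [hX L le_rfl, funext_iff]
    refine forall_congr' fun i => ?_
    have hF : ∀ a t, F a (w t).2 i = (θ i).1 a ⬝ᵥ (w t).2 := fun a t => rfl
    have hQ : ∀ a t, Q a (w t).1 i = (θ i).2 a ⬝ᵥ (w t).1 := fun a t => rfl
    simp only [Pi.sub_apply, Finset.sum_apply, Pi.add_apply, Pi.zero_apply, g, hF, hQ,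
      Nat.sub_self, zero_add, ARXRow.eval, Finset.sum_range_succ, Finset.sum_add_distrib]
    constructor <;> intro h <;> linarith
  rw [hXL]
  constructor
  · rintro ⟨x, hx⟩
    have key : ∀ k ≤ L, ∀ t, X k t = c k (x t) := by
      intro k
      induction k with
      | zero =>
        intro _ t
        rw [hX0, (hx t).2]
        abel
      | succ k ih =>
        intro hk t
        rw [hXs, ih (by omega), hc k (by omega), (hx t).1]
        simp only [g, (hx t).2, Pi.add_apply, LinearMap.pi_apply, LinearMap.add_apply,
          LinearMap.comp_apply, map_add]
        abel
    intro t
    rw [key L le_rfl, hcL]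
  · intro h
    have hcX : ∀ k ≤ L, ∀ t, c k (fun k : Fin L => X k t) = X k t := by
      intro k hk t
      rcases hk.lt_or_eq with hk | rfl
      · rw [hc k hk]
      · rw [hcL, h]
    refine ⟨fun t k => X k t, fun t => ⟨?_, ?_⟩⟩
    · funext k
      simp only [Pi.add_apply, LinearMap.pi_apply, LinearMap.add_apply, LinearMap.comp_apply]
      rw [hcX _ (by omega), hcX _ (by omega), hXs, hX0]
      simp only [g, map_sub]
      abel
    · rw [hcX 0 (by omega), hX0]
      abel

theorem arxBehavior_mem_systems (L : ℕ) (θ : Fin p → ARXRow m p) :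
    arxBehavior L θ ∈ systems m p := by
  obtain ⟨n, S, hS⟩ := exists_stateSpace_arxBehavior L θ
  exact ⟨hS ▸ S.isLTIComplete_behavior, n, S, hS⟩

theorem exists_sum_dotProduct_eq {L q : ℕ} (φ : (Fin L → Fin q → ℝ) →ₗ[ℝ] ℝ) :
    ∃ f : ℕ → Fin q → ℝ, ∀ z : ℕ → Fin q → ℝ,
      φ (fun k => z k) = ∑ a ∈ Finset.range L, f a ⬝ᵥ z a := by
  refine ⟨fun a i => if h : a < L then φ (Pi.single ⟨a, h⟩ (Pi.single i 1)) else 0, fun z => ?_⟩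
  rw [Finset.sum_range, ← Finset.univ_sum_single (fun k : Fin L => z k), map_sum]
  refine Finset.sum_congr rfl fun k _ => ?_
  have h := (φ ∘ₗ LinearMap.single ℝ (fun _ : Fin L => Fin q → ℝ) k).pi_apply_eq_sum_univ (z k)
  simp only [LinearMap.comp_apply, LinearMap.single_apply] at h
  rw [h, dotProduct]
  refine Finset.sum_congr rfl fun i _ => ?_
  have hs : (fun j : Fin q => if i = j then (1 : ℝ) else 0) = Pi.single i 1 := by
    ext j
    simp [Pi.single_apply, eq_comm]
  simp only [hs, smul_eq_mul, mul_comm, dif_pos k.2]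

/-! ### Enclosing a state space system in an ARX model; the impulse response -/

namespace StateSpace

theorem output_add (S : StateSpace n m p) {w : ℕ → Signal m p} {x : ℕ → Fin n → ℝ}
    (hx : ∀ t, x (t + 1) = S.A *ᵥ x t + S.B *ᵥ (w t).1 ∧ (w t).2 = S.C *ᵥ x t + S.D *ᵥ (w t).1)
    (t a : ℕ) : (w (t + a)).2 = (S.C * S.A ^ a) *ᵥ x t +
      ∑ s ∈ Finset.range (a + 1), S.impulseResponse (a - s) *ᵥ (w (t + s)).1 := by
  have hstate : ∀ a, x (t + a) = S.A ^ a *ᵥ x t +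
      ∑ s ∈ Finset.range a, (S.A ^ (a - 1 - s) * S.B) *ᵥ (w (t + s)).1 := by
    intro a
    induction a with
    | zero => simp
    | succ a ih =>
      rw [← add_assoc, (hx (t + a)).1, ih, Matrix.mulVec_add, Matrix.mulVec_mulVec, ← pow_succ',
        Finset.sum_range_succ, Matrix.mulVec_sum, add_assoc]
      congr 2
      · refine Finset.sum_congr rfl fun s hs => ?_
        have hs := Finset.mem_range.1 hs
        rw [Matrix.mulVec_mulVec, ← Matrix.mul_assoc, ← pow_succ',
          show a - 1 - s + 1 = a + 1 - 1 - s by omega]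
      · simp
  rw [(hx (t + a)).2, hstate a, Matrix.mulVec_add, Matrix.mulVec_mulVec, Matrix.mulVec_sum,
    Finset.sum_range_succ, add_assoc]
  congr 2
  · refine Finset.sum_congr rfl fun s hs => ?_
    have hs := Finset.mem_range.1 hs
    rw [Matrix.mulVec_mulVec, show a - s = a - 1 - s + 1 by omega, impulseResponse,
      ← Matrix.mul_assoc]
  · rw [Nat.sub_self, impulseResponse]

/-- If the states are determined by `L` successive outputs, the behavior is contained in an
autoregressive model of order `L` with exogenous inputs. -/
theorem exists_behavior_le_arxBehavior (S : StateSpace n m p) (L : ℕ)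
    (hL : ∀ x, (∀ t < L, (S.C * S.A ^ t) *ᵥ x = 0) → x = 0) :
    ∃ θ : Fin p → ARXRow m p, S.behavior ≤ arxBehavior L θ := by
  let O : (Fin n → ℝ) →ₗ[ℝ] (Fin L → Fin p → ℝ) :=
    LinearMap.pi fun k => (S.C * S.A ^ (k : ℕ)).mulVecLin
  have hO : LinearMap.ker O = ⊥ := by
    rw [LinearMap.ker_eq_bot']
    exact fun x hx => hL x fun t ht => congrFun hx ⟨t, ht⟩
  -- `K` recovers `x t` from `L` outputs once the input contribution is removed; substituting this
  -- into the formula for the output at `t + L` gives the ARX equation.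
  obtain ⟨K, hK⟩ := O.exists_leftInverse_of_injective hO
  -- `Fin.ofNat` reduces modulo `L + 1`, which has no effect for the indices `k ≤ L` used here.
  let conv : ℕ → (Fin (L + 1) → Fin m → ℝ) →ₗ[ℝ] (Fin p → ℝ) := fun k =>
    ∑ s ∈ Finset.range (k + 1), (S.impulseResponse (k - s)).mulVecLin ∘ₗ
      LinearMap.proj (Fin.ofNat (L + 1) s)
  have hconv : ∀ k ≤ L, ∀ u : ℕ → Fin m → ℝ, conv k (fun s => u s) =
      ∑ s ∈ Finset.range (k + 1), S.impulseResponse (k - s) *ᵥ u s := by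
    intro k hk u
    simp only [conv, LinearMap.sum_apply]
    refine Finset.sum_congr rfl fun s hs => ?_
    have hs := Finset.mem_range.1 hs
    rw [LinearMap.comp_apply, LinearMap.proj_apply, Matrix.mulVecLin_apply, Fin.val_ofNat,
      Nat.mod_eq_of_lt (by omega)]
  let φ : Fin p → (Fin L → Fin p → ℝ) →ₗ[ℝ] ℝ := fun i =>
    LinearMap.proj i ∘ₗ (S.C * S.A ^ L).mulVecLin ∘ₗ K
  choose f hf using fun i => exists_sum_dotProduct_eq (φ i)
  choose q hq using fun i => exists_sum_dotProduct_eq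
    (LinearMap.proj i ∘ₗ conv L - φ i ∘ₗ LinearMap.pi fun k : Fin L => conv k)
  refine ⟨fun i => (f i, q i), ?_⟩
  rintro w ⟨x, hx⟩ t i
  have hy : ∀ a ≤ L, (w (t + a)).2 = (S.C * S.A ^ a) *ᵥ x t +
      conv a (fun s => (w (t + s)).1) := by
    intro a ha
    rw [S.output_add hx, hconv a ha fun s => (w (t + s)).1]
  have hyO : (fun k : Fin L => (w (t + k)).2) =
      O (x t) + LinearMap.pi (fun k : Fin L => conv k) (fun s => (w (t + s)).1) := by
    funext k
    exact hy k k.2.le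
  have hKO : K (O (x t)) = x t := LinearMap.congr_fun hK (x t)
  rw [ARXRow.eval, ← hf i fun a => (w (t + a)).2, ← hq i fun a => (w (t + a)).1, hyO,
    hy L le_rfl, map_add]
  have hφ : φ i (O (x t)) = ((S.C * S.A ^ L) *ᵥ x t) i := by
    simp only [φ, LinearMap.comp_apply, hKO]
    rfl
  rw [hφ]
  simp

/-- The response to a unit impulse at time `L` in the `j`-th input. -/
noncomputable def impulseTrajectory (S : StateSpace n m p) (L : ℕ) (j : Fin m) : ℕ → Signal m p :=
  fun t => (if t = L then Pi.single j 1 else 0,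
    if t < L then 0 else (S.impulseResponse (t - L)).col j)

theorem impulseTrajectory_mem (S : StateSpace n m p) (L : ℕ) (j : Fin m) :
    S.impulseTrajectory L j ∈ S.behavior := by
  refine ⟨fun t => if t ≤ L then 0 else (S.A ^ (t - L - 1) * S.B).col j, fun t => ?_⟩
  rcases lt_trichotomy t L with h | rfl | h
  · simp [impulseTrajectory, h, h.le, h.ne, Nat.succ_le_of_lt h]
  · simp [impulseTrajectory, impulseResponse]
  · obtain ⟨k, rfl⟩ := Nat.exists_eq_add_of_lt h
    have e2 : L + k + 1 + 1 - L - 1 = k + 1 := by omega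
    have e3 : L + k + 1 - L = k + 1 := by omega
    have n1 : ¬ L + k + 1 + 1 ≤ L := by omega
    have n2 : ¬ L + k + 1 ≤ L := by omega
    have n3 : ¬ L + k + 1 < L := by omega
    have n4 : ¬ L + k + 1 = L := by omega
    simp only [impulseTrajectory, n1, n2, n3, n4, if_false, e2, e3, impulseResponse,
      Nat.add_sub_cancel, Matrix.mulVec_zero, add_zero]
    constructor
    · rw [← Matrix.mulVec_single_one, ← Matrix.mulVec_single_one, Matrix.mulVec_mulVec,
        ← Matrix.mul_assoc, ← pow_succ']
    · rw [← Matrix.mulVec_single_one, ← Matrix.mulVec_single_one, Matrix.mulVec_mulVec,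
        Matrix.mul_assoc]

/-- The recursion for the impulse response of an autoregressive model. -/
theorem impulseResponse_eq_eval {S : StateSpace n m p} {L : ℕ} {θ : Fin p → ARXRow m p}
    (h : S.behavior ≤ arxBehavior L θ) (k : ℕ) (i : Fin p) (j : Fin m) :
    S.impulseResponse k i j = (θ i).eval L (S.impulseTrajectory L j) k := by
  -- With the impulse at time `L`, the equation at time `k` predicts the output at `k + L`, which is
  -- the impulse response at `k`. Containment in the ARX model is enough for this.
  rw [← h (S.impulseTrajectory_mem L j) k i]
  simp [impulseTrajectory]

/-- At time `k` the equation reads outputs at times below `k + L`, that is, impulse response entries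
of index below `k` or zeros. All rows `i` are needed because an equation couples all outputs. -/
theorem eval_impulseTrajectory_congr {n' : ℕ} {S : StateSpace n m p} {S' : StateSpace n' m p}
    {j : Fin m} {k : ℕ}
    (h : ∀ l < k, ∀ i, S.impulseResponse l i j = S'.impulseResponse l i j) (L : ℕ)
    (ρ : ARXRow m p) :
    ρ.eval L (S.impulseTrajectory L j) k = ρ.eval L (S'.impulseTrajectory L j) k := by
  refine ARXRow.eval_congr _ (fun a ha => ?_) fun a _ => rfl
  simp only [impulseTrajectory]
  split_ifs with hka
  · rfl
  · funext i
    exact h (k + a - L) (by omega) i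

theorem impulseResponse_eq_of_le_arxBehavior {n' : ℕ} {S : StateSpace n m p}
    {S' : StateSpace n' m p} {L : ℕ} {θ : Fin p → ARXRow m p}
    (h : S.behavior ≤ arxBehavior L θ) (h' : S'.behavior ≤ arxBehavior L θ) :
    S.impulseResponse = S'.impulseResponse := by
  suffices ∀ k i j, S.impulseResponse k i j = S'.impulseResponse k i j by
    funext k i j
    exact this k i j
  intro k
  induction k using Nat.strong_induction_on with
  | _ k ih =>
    intro i j
    rw [impulseResponse_eq_eval h, impulseResponse_eq_eval h']
    exact eval_impulseTrajectory_congr (fun l hl i => ih l hl i j) _ _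

/-- Representations of the same behavior have the same impulse response. -/
theorem impulseResponse_eq_of_behavior_eq {n' : ℕ} {S : StateSpace n m p}
    {S' : StateSpace n' m p} (h : S.behavior = S'.behavior) :
    S.impulseResponse = S'.impulseResponse := by
  -- A minimal representation supplies an ARX model that contains the common behavior.
  obtain ⟨n₀, S₀, h₀, hmin⟩ := S.exists_isMinimal
  obtain ⟨θ, hθ⟩ := S₀.exists_behavior_le_arxBehavior n₀
    ((S₀.rank_obsMatrix_eq_iff n₀).1 hmin.rank_obsMatrix)
  rw [h₀] at hθ
  exact impulseResponse_eq_of_le_arxBehavior hθ (h ▸ hθ)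

end StateSpace

/-! ### The lag of ARX models -/

/-- A system of lag at most `L` is contained in an autoregressive model of order `L`. -/
theorem exists_le_arxBehavior {𝔅 : Behavior m p} (h : 𝔅 ∈ systems m p) {L : ℕ} (hL : lag 𝔅 ≤ L) :
    ∃ θ : Fin p → ARXRow m p, 𝔅 ≤ arxBehavior L θ := by
  obtain ⟨n, S, rfl, -, hrk⟩ := exists_isMinimal_rank_obsMatrix_lag h
  rw [S.rank_obsMatrix_eq_iff] at hrk
  exact S.exists_behavior_le_arxBehavior L fun x hx => hrk x fun t ht => hx t (ht.trans_le hL)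

/-- Upper bound: with zero input, outputs that vanish for `L` steps vanish forever by the recursion,
so observability makes the state zero. Lower bound: the first `L` outputs are free, hence `L * p ≤
n`, while an observability matrix of rank `n` with `lag * p` rows gives `n ≤ lag * p`. Cancelling
`p` needs `0 < p`. -/
theorem lag_arxBehavior (hp : 0 < p) (L : ℕ) (θ : Fin p → ARXRow m p) :
    lag (arxBehavior L θ) = L := by
  have hout : ∀ {n : ℕ} {S : StateSpace n m p} {w : ℕ → Signal m p} {x : ℕ → Fin n → ℝ},
      (∀ t, (w t).1 = 0) →
      (∀ t, x (t + 1) = S.A *ᵥ x t + S.B *ᵥ (w t).1 ∧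
        (w t).2 = S.C *ᵥ x t + S.D *ᵥ (w t).1) →
      ∀ a, (w a).2 = (S.C * S.A ^ a) *ᵥ x 0 := by
    intro n S w x hu hx a
    have := S.output_add hx 0 a
    simpa [hu] using this
  apply le_antisymm
  · obtain ⟨n, S₀, h₀⟩ := exists_stateSpace_arxBehavior L θ
    obtain ⟨n', S, hS, hmin⟩ := S₀.exists_isMinimal
    rw [h₀] at hS
    refine Nat.sInf_le ⟨n', S, hS, hmin, (S.rank_obsMatrix_eq_iff L).2 fun x hx => ?_⟩
    have hmem : (fun t => (0, (S.C * S.A ^ t) *ᵥ x) : ℕ → Signal m p) ∈ S.behavior :=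
      ⟨fun t => S.A ^ t *ᵥ x, fun t => by simp [Matrix.mulVec_mulVec, pow_succ']⟩
    rw [hS] at hmem
    have hzero : ∀ t, (S.C * S.A ^ t) *ᵥ x = 0 := by
      intro t
      induction t using Nat.strong_induction_on with
      | _ t ih =>
        rcases Nat.lt_or_ge t L with ht | ht
        · exact hx t ht
        · obtain ⟨s, rfl⟩ := Nat.exists_eq_add_of_le' ht
          funext i
          have h := hmem s i
          refine h.trans ?_
          simp only [ARXRow.eval, dotProduct_zero, Finset.sum_const_zero, add_zero]
          refine Finset.sum_eq_zero fun a ha => ?_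
          rw [ih (s + a) (by have := Finset.mem_range.1 ha; omega), dotProduct_zero]
    have : x ∈ S.unobservable := (S.mem_unobservable x).2 hzero
    rwa [hmin.unobservable_eq_bot] at this
  · obtain ⟨n, S, hS, -, hrk⟩ :=
      exists_isMinimal_rank_obsMatrix_lag (arxBehavior_mem_systems L θ)
    have h1 : n ≤ lag (arxBehavior L θ) * p := by
      rw [← hrk]
      simpa using (S.obsMatrix (lag (arxBehavior L θ))).rank_le_card_height
    have h2 : L * p ≤ n := by
      let O : (Fin n → ℝ) →ₗ[ℝ] (Fin L → Fin p → ℝ) :=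
        LinearMap.pi fun k => (S.C * S.A ^ (k : ℕ)).mulVecLin
      have hO : LinearMap.range O = ⊤ := by
        rw [LinearMap.range_eq_top]
        intro c
        -- With `N = 0` there is nothing to check: only the `L` initial outputs are prescribed.
        obtain ⟨w, hw, hu, hy⟩ := exists_mem_arxBehavior 0 L θ
          (fun t => ((0 : Fin m → ℝ), if h : t < L then c ⟨t, h⟩ else 0)) (fun t i h => by omega)
        rw [← hS] at hw
        obtain ⟨x, hx⟩ := hw
        refine ⟨x 0, ?_⟩
        funext k
        have := hout hu hx k
        rw [hy k (Or.inr k.2)] at this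
        simpa [O] using this.symm
      have := O.finrank_range_le
      rw [hO, finrank_top] at this
      simpa [finrank_pi_fintype] using this
    exact Nat.le_of_mul_le_mul_right (h2.trans h1) hp

/-! ### Induced SISO systems in terms of impulse response entries -/

theorem exists_stateSpace_inducedSISO (S : StateSpace n m p) (i : Fin p) (j : Fin m) :
    ∃ S' : StateSpace n 1 1, S'.behavior = inducedSISO S.behavior i j ∧
      ∀ k, S'.impulseResponse k 0 0 = S.impulseResponse k i j := by
  refine ⟨⟨S.A, S.B.submatrix id fun _ => j, S.C.submatrix (fun _ => i) id,
    S.D.submatrix (fun _ => i) fun _ => j⟩, ?_, ?_⟩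
  · have hB : ∀ (q : ℕ) (M : Matrix (Fin q) (Fin m) ℝ) (u : Fin 1 → ℝ) (v : Fin m → ℝ),
        u 0 = v j → (∀ k, k ≠ j → v k = 0) → M.submatrix id (fun _ => j) *ᵥ u = M *ᵥ v := by
      intro q M u v huv hv
      funext a
      simp only [Matrix.mulVec, dotProduct, Matrix.submatrix_apply, id]
      rw [Fin.sum_univ_one, Finset.sum_eq_single j (fun k _ hk => by rw [hv k hk, mul_zero])
        (fun h => absurd (Finset.mem_univ j) h), huv]
    ext w
    constructor
    · rintro ⟨x, hx⟩
      refine ⟨fun t => (Pi.single j ((w t).1 0),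
        S.C *ᵥ x t + S.D *ᵥ Pi.single j ((w t).1 0)), ⟨x, fun t => ⟨?_, rfl⟩⟩,
        fun t => ⟨by simp, ?_, fun k hk => by simp [hk]⟩⟩
      · rw [(hx t).1]
        congr 1
        exact hB _ S.B _ _ (by simp) fun k hk => by simp [hk]
      · rw [(hx t).2]
        have h := congrFun (hB _ S.D (w t).1 (Pi.single j ((w t).1 0)) (by simp)
          fun k hk => by simp [hk]) i
        simp only [Pi.add_apply]
        rw [← h]
        rfl
    · rintro ⟨v, ⟨x, hx⟩, hv⟩
      refine ⟨x, fun t => ⟨?_, ?_⟩⟩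
      · rw [(hx t).1]
        congr 1
        exact (hB _ S.B _ _ (hv t).1 (hv t).2.2).symm
      · funext a
        have h := congrFun (hB _ S.D (w t).1 (v t).1 (hv t).1 (hv t).2.2) i
        rw [Subsingleton.elim a 0, (hv t).2.1, (hx t).2, Pi.add_apply, ← h]
        rfl
  · intro k
    cases k <;> rfl

theorem relativeDegree_behavior (S : StateSpace n 1 1) :
    relativeDegree S.behavior = S.relativeDegree := by
  have : {r | ∃ (n' : ℕ) (S' : StateSpace n' 1 1),
      S'.behavior = S.behavior ∧ S'.relativeDegree = r} = {S.relativeDegree} := by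
    ext r
    constructor
    · rintro ⟨n', S', h, rfl⟩
      simp only [Set.mem_singleton_iff, StateSpace.relativeDegree,
        StateSpace.impulseResponse_eq_of_behavior_eq h]
    · rintro rfl
      exact ⟨n, S, rfl, rfl⟩
  rw [relativeDegree, this, sInf_singleton]

/-- Stated as a lower bound, so that it also covers infinite relative degree. -/
theorem natCast_le_relativeDegree_inducedSISO_iff (S : StateSpace n m p) (i : Fin p) (j : Fin m)
    (r : ℕ) : (r : ℕ∞) ≤ relativeDegree (inducedSISO S.behavior i j) ↔
      ∀ k < r, S.impulseResponse k i j = 0 := by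
  obtain ⟨S', hS', himp⟩ := exists_stateSpace_inducedSISO S i j
  rw [← hS', relativeDegree_behavior, StateSpace.relativeDegree]
  simp only [le_iInf_iff, himp, Nat.cast_le]
  refine forall_congr' fun k => ?_
  rw [← not_lt, not_imp_not]

theorem relativeDegree_inducedSISO_eq_iff (S : StateSpace n m p) (i : Fin p) (j : Fin m)
    (r : ℕ) : relativeDegree (inducedSISO S.behavior i j) = r ↔
      (∀ k < r, S.impulseResponse k i j = 0) ∧ S.impulseResponse r i j ≠ 0 := by
  have h := natCast_le_relativeDegree_inducedSISO_iff S i j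
  constructor
  · intro hr
    refine ⟨(h r).1 hr.ge, fun h0 => ?_⟩
    have h1 := (h (r + 1)).2 fun k hk => by
      rcases Nat.lt_succ_iff_lt_or_eq.1 hk with hk | rfl
      · exact (h r).1 hr.ge k hk
      · exact h0
    rw [hr, Nat.cast_le] at h1
    omega
  · rintro ⟨h0, h1⟩
    refine le_antisymm ?_ ((h r).2 h0)
    by_contra hlt
    rw [not_le] at hlt
    have h2 : ((r + 1 : ℕ) : ℕ∞) ≤ relativeDegree (inducedSISO S.behavior i j) := by
      push_cast
      exact Order.add_one_le_of_lt hlt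
    exact h1 ((h (r + 1)).1 h2 r (Nat.lt_succ_self r))

theorem hasLeadingValue_inducedSISO_iff (S : StateSpace n m p) (i : Fin p) (j : Fin m)
    (a : ℝ) : HasLeadingValue (inducedSISO S.behavior i j) a ↔
      ∃ k, (∀ l < k, S.impulseResponse l i j = 0) ∧ S.impulseResponse k i j = a ∧ a ≠ 0 := by
  obtain ⟨S', hS', himp⟩ := exists_stateSpace_inducedSISO S i j
  constructor
  · rintro ⟨n', S'', h, hk⟩
    rw [StateSpace.impulseResponse_eq_of_behavior_eq (h.trans hS'.symm)] at hk
    simpa only [himp] using hk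
  · intro hk
    refine ⟨n, S', hS', ?_⟩
    simpa only [himp] using hk

theorem StateSpace.decouplingMatrix_apply (S : StateSpace n m p) (r : Fin p → ℕ) (i : Fin p)
    (j : Fin m) : S.decouplingMatrix r i j = S.impulseResponse (r i) i j := by
  rw [StateSpace.decouplingMatrix, Matrix.of_apply]
  rcases Nat.eq_zero_or_pos (r i) with h | h
  · rw [if_pos h, h, impulseResponse]
  · obtain ⟨k, hk⟩ := Nat.exists_eq_succ_of_ne_zero h.ne'
    rw [if_neg h.ne', hk, Nat.succ_sub_one, impulseResponse]

/-! ### The perturbation argument -/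

variable {T : ℕ} {Λ : Set ℕ} {d : Fin (T + 1) → Signal m p}

theorem Explains.mono {𝔅 𝔅' : Behavior m p} (h : 𝔅 ≤ 𝔅') (hd : Explains 𝔅 d) : Explains 𝔅' d :=
  let ⟨w, hw, hwd⟩ := hd
  ⟨w, h hw, hwd⟩

/-- Replacing one equation of an autoregressive model that explains the data by its sum with a
multiple of the difference of two equations that hold for the data yields a model that explains
the data. -/
theorem Explains.arxBehavior_update {L : ℕ} {θ θ' : Fin p → ARXRow m p}
    (h : Explains (arxBehavior L θ) d) (h' : Explains (arxBehavior L θ') d) (i i' : Fin p) (c : ℝ) :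
    Explains (arxBehavior L (Function.update θ i (θ i + c • (θ i' - θ' i')))) d := by
  obtain ⟨w, hw, hwd⟩ := h
  obtain ⟨w', hw', hwd'⟩ := h'
  have hww : ∀ t < T + 1, w' t = w t := fun t ht => (hwd' ⟨t, ht⟩).trans (hwd ⟨t, ht⟩).symm
  -- The perturbed equations hold for `w` only on the data window, so `w` is cut off there and
  -- continued anew.
  obtain ⟨v, hv, -, hvw⟩ := exists_mem_arxBehavior (T + 1) L
    (Function.update θ i (θ i + c • (θ i' - θ' i'))) w fun t k ht => by
      rcases eq_or_ne k i with rfl | hk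
      · have h2 : (θ' i').eval L w t = (w (t + L)).2 i' := by
          rw [← hww _ ht, hw' t i']
          exact ARXRow.eval_congr _ (fun a ha => by rw [hww _ (by omega)])
            fun a ha => by rw [hww _ (by omega)]
        rw [Function.update_self, ARXRow.eval_add, ARXRow.eval_smul, ARXRow.eval_sub, ← hw t k,
          ← hw t i', h2, sub_self, mul_zero, add_zero]
      · rw [Function.update_of_ne hk, hw t k]
  exact ⟨v, hv, fun t => (hvw t (Or.inl t.2)).trans (hwd t)⟩

/-- Perturbing row `i` by `c` times the difference of the rows `i'` moves the entry at index `k`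
along the affine function `a + cδ`; a relative degree independent of `c` forces `δ = 0`. The models
are quantified inside the induction on `k` because the induction hypothesis also compares `θ` with
the perturbed model. -/
theorem impulseResponse_eq_of_informative_of_le_arxBehavior {i : Fin p} {j : Fin m} {r : ℕ}
    (hinf : Informative (modelClass m p Λ) d fun 𝔅 => relativeDegree (inducedSISO 𝔅 i j) = r)
    {L : ℕ} (hL : L ∈ Λ) (k : ℕ) (hk : k ≤ r) :
    ∀ {θ θ' : Fin p → ARXRow m p}, Explains (arxBehavior L θ) d → Explains (arxBehavior L θ') d →
    ∀ {n n' : ℕ} {S : StateSpace n m p} {S' : StateSpace n' m p},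
      S.behavior ≤ arxBehavior L θ → S'.behavior ≤ arxBehavior L θ' →
    ∀ i', S.impulseResponse k i' j = S'.impulseResponse k i' j := by
  induction k using Nat.strong_induction_on with
  | _ k ih =>
    intro θ θ' hθ hθ' n n' S S' hS hS' i'
    have hcongr := StateSpace.eval_impulseTrajectory_congr (S := S) (S' := S')
      (fun l hl i => ih l hl (by omega) hθ hθ' hS hS' i) L
    rw [StateSpace.impulseResponse_eq_eval hS, StateSpace.impulseResponse_eq_eval hS', ← hcongr,
      ← sub_eq_zero, ← ARXRow.eval_sub]
    set δ := ARXRow.eval L (θ i' - θ' i') (S.impulseTrajectory L j) k with hδ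
    set a := ARXRow.eval L (θ i) (S.impulseTrajectory L j) k with ha
    have hpert : ∀ c : ℝ, (k < r → a + c * δ = 0) ∧ (k = r → a + c * δ ≠ 0) := by
      intro c
      have hex := hθ.arxBehavior_update hθ' i i' c
      set θc := Function.update θ i (θ i + c • (θ i' - θ' i')) with hθc
      obtain ⟨nc, Sc, hSc⟩ := exists_stateSpace_arxBehavior (m := m) L θc
      have hrd := (hinf ⟨⟨arxBehavior_mem_systems L θc,
        (lag_arxBehavior i.pos L θc).symm ▸ hL⟩, hex⟩).2
      rw [← hSc, relativeDegree_inducedSISO_eq_iff] at hrd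
      have hval : Sc.impulseResponse k i j = a + c * δ := by
        rw [StateSpace.impulseResponse_eq_eval hSc.le,
          ← StateSpace.eval_impulseTrajectory_congr (S := S)
            (fun l hl i => ih l hl (by omega) hθ hex hS hSc.le i) L,
          hθc, Function.update_self, ARXRow.eval_add, ARXRow.eval_smul]
      rw [← hval]
      exact ⟨hrd.1 k, fun h => h ▸ hrd.2⟩
    rcases hk.lt_or_eq with hk | hk
    · have h0 := (hpert 0).1 hk
      have h1 := (hpert 1).1 hk
      linarith
    · by_contra hne
      -- For `δ ≠ 0` this choice of `c` would annihilate the leading value.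
      refine (hpert (-a / δ)).2 hk ?_
      field_simp
      ring

/-- If the data determine the relative degree `r` from input `j` to output `i`, they determine the
`j`-th column of the impulse response up to the index `r`. -/
theorem impulseResponse_eq_of_informative {i : Fin p} {j : Fin m} {r : ℕ}
    (hinf : Informative (modelClass m p Λ) d fun 𝔅 => relativeDegree (inducedSISO 𝔅 i j) = r)
    {n n' : ℕ} {S : StateSpace n m p} {S' : StateSpace n' m p}
    (hS : S.behavior ∈ explaining (modelClass m p Λ) d)
    (hS' : S'.behavior ∈ explaining (modelClass m p Λ) d) {k : ℕ} (hk : k ≤ r) (i' : Fin p) :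
    S.impulseResponse k i' j = S'.impulseResponse k i' j := by
  obtain ⟨θ, hθ⟩ := exists_le_arxBehavior hS.1.1 (le_max_left _ (lag S'.behavior))
  obtain ⟨θ', hθ'⟩ := exists_le_arxBehavior hS'.1.1 (le_max_right (lag S.behavior) _)
  -- The common order is itself one of the two lags, so no structure on `Λ` is needed.
  have hL : max (lag S.behavior) (lag S'.behavior) ∈ Λ := by
    rcases max_choice (lag S.behavior) (lag S'.behavior) with h | h
    · exact h.symm ▸ hS.1.2
    · exact h.symm ▸ hS'.1.2
  exact impulseResponse_eq_of_informative_of_le_arxBehavior hinf hL k hk (hS.2.mono hθ)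
    (hS'.2.mono hθ') hθ hθ' i'

/-! ### Row minima, the decoupling matrix and the vector relative degree -/

theorem row_ne_zero_of_rank_eq {G : Matrix (Fin p) (Fin m) ℝ} (h : G.rank = p) (i : Fin p) :
    G i ≠ 0 := by
  have hli : LinearIndependent ℝ G.row := by
    rw [linearIndependent_iff_card_eq_finrank_span, Fintype.card_fin, Set.finrank,
      ← Matrix.rank_eq_finrank_span_row, h]
  exact hli.ne_zero i

theorem rowMin_le_relativeDegree {𝓜 : Set (Behavior m p)} {𝔅 : Behavior m p} {i : Fin p}
    {j : Fin m} (h𝔅 : 𝔅 ∈ explaining 𝓜 d) (hj : (i, j) ∈ informativePairs 𝓜 d) :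
    (rowMin 𝓜 d 𝔅 i : ℕ∞) ≤ relativeDegree (inducedSISO 𝔅 i j) := by
  obtain ⟨r, hr⟩ := id hj
  have hr𝔅 : relativeDegree (inducedSISO 𝔅 i j) = r := (hr h𝔅).2
  rw [hr𝔅, Nat.cast_le]
  exact Nat.sInf_le ⟨j, hj, hr𝔅⟩

/-- An informative pair in the row rules out the default value of `sInf ∅`. -/
theorem exists_relativeDegree_eq_rowMin {𝓜 : Set (Behavior m p)} {𝔅 : Behavior m p} {i : Fin p}
    (h𝔅 : 𝔅 ∈ explaining 𝓜 d) (hrow : ∃ j, (i, j) ∈ informativePairs 𝓜 d) :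
    ∃ j, (i, j) ∈ informativePairs 𝓜 d ∧
      relativeDegree (inducedSISO 𝔅 i j) = (rowMin 𝓜 d 𝔅 i : ℕ∞) := by
  obtain ⟨j, hj⟩ := hrow
  obtain ⟨r, hr⟩ := id hj
  exact Nat.sInf_mem (s := {r : ℕ | ∃ j, (i, j) ∈ informativePairs 𝓜 d ∧
    relativeDegree (inducedSISO 𝔅 i j) = r}) ⟨r, j, hj, (hr h𝔅).2⟩

theorem relativeDegree_eq_of_mem_informativePairs {𝓜 : Set (Behavior m p)} {𝔅 𝔅' : Behavior m p}
    {i : Fin p} {j : Fin m} (h𝔅 : 𝔅 ∈ explaining 𝓜 d) (h𝔅' : 𝔅' ∈ explaining 𝓜 d)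
    (hj : (i, j) ∈ informativePairs 𝓜 d) :
    relativeDegree (inducedSISO 𝔅' i j) = relativeDegree (inducedSISO 𝔅 i j) := by
  obtain ⟨r, hr⟩ := hj
  exact (hr h𝔅').2.trans (hr h𝔅).2.symm

theorem rowMin_le_relativeDegree_of_mem_explaining {𝔅 : Behavior m p}
    (h𝔅 : 𝔅 ∈ explaining (modelClass m p Λ) d)
    (hlow : ∀ (i : Fin p) (j : Fin m), (i, j) ∉ informativePairs (modelClass m p Λ) d →
      ∀ 𝔅' ∈ explaining (modelClass m p Λ) d,
        (rowMin (modelClass m p Λ) d 𝔅 i : ℕ∞) + 1 ≤ relativeDegree (inducedSISO 𝔅' i j))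
    {𝔅' : Behavior m p} (h𝔅' : 𝔅' ∈ explaining (modelClass m p Λ) d) (i : Fin p) (j : Fin m) :
    (rowMin (modelClass m p Λ) d 𝔅 i : ℕ∞) ≤ relativeDegree (inducedSISO 𝔅' i j) := by
  by_cases hj : (i, j) ∈ informativePairs (modelClass m p Λ) d
  · rw [relativeDegree_eq_of_mem_informativePairs h𝔅 h𝔅' hj]
    exact rowMin_le_relativeDegree h𝔅 hj
  · exact le_self_add.trans (hlow i j hj 𝔅' h𝔅')

theorem rowMin_eq_iInf_relativeDegree {𝔅 : Behavior m p}
    (h𝔅 : 𝔅 ∈ explaining (modelClass m p Λ) d)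
    (hlow : ∀ (i : Fin p) (j : Fin m), (i, j) ∉ informativePairs (modelClass m p Λ) d →
      ∀ 𝔅' ∈ explaining (modelClass m p Λ) d,
        (rowMin (modelClass m p Λ) d 𝔅 i : ℕ∞) + 1 ≤ relativeDegree (inducedSISO 𝔅' i j))
    (hrow : ∀ i : Fin p, ∃ j : Fin m, (i, j) ∈ informativePairs (modelClass m p Λ) d)
    {𝔅' : Behavior m p} (h𝔅' : 𝔅' ∈ explaining (modelClass m p Λ) d) (i : Fin p) :
    (rowMin (modelClass m p Λ) d 𝔅 i : ℕ∞) = ⨅ j, relativeDegree (inducedSISO 𝔅' i j) := by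
  refine le_antisymm
    (le_iInf fun j => rowMin_le_relativeDegree_of_mem_explaining h𝔅 hlow h𝔅' i j) ?_
  obtain ⟨j, hj, hr⟩ := exists_relativeDegree_eq_rowMin h𝔅 (hrow i)
  rw [← hr, ← relativeDegree_eq_of_mem_informativePairs h𝔅 h𝔅' hj]
  exact iInf_le _ j

/-- All systems that explain the data have the same decoupling matrix. -/
theorem decouplingMatrix_rowMin_eq {n : ℕ} {S : StateSpace n m p}
    (hS : S.behavior ∈ explaining (modelClass m p Λ) d)
    (hlow : ∀ (i : Fin p) (j : Fin m), (i, j) ∉ informativePairs (modelClass m p Λ) d →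
      ∀ 𝔅' ∈ explaining (modelClass m p Λ) d,
        (rowMin (modelClass m p Λ) d S.behavior i : ℕ∞) + 1 ≤ relativeDegree (inducedSISO 𝔅' i j))
    {n' : ℕ} {S' : StateSpace n' m p} (hS' : S'.behavior ∈ explaining (modelClass m p Λ) d) :
    S'.decouplingMatrix (rowMin (modelClass m p Λ) d S.behavior) =
      S.decouplingMatrix (rowMin (modelClass m p Λ) d S.behavior) := by
  ext i j
  rw [S'.decouplingMatrix_apply, S.decouplingMatrix_apply]
  by_cases hj : (i, j) ∈ informativePairs (modelClass m p Λ) d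
  · obtain ⟨r, hr⟩ := id hj
    have h := rowMin_le_relativeDegree hS hj
    rw [(hr hS).2, Nat.cast_le] at h
    exact impulseResponse_eq_of_informative hr hS' hS h i
  -- Here the bound must be `r_i + 1`: it makes the entry at index `r_i` itself vanish.
  · have h0 : ∀ {k : ℕ} {R : StateSpace k m p}, R.behavior ∈ explaining (modelClass m p Λ) d →
        R.impulseResponse (rowMin (modelClass m p Λ) d S.behavior i) i j = 0 := by
      intro k R hR
      exact (natCast_le_relativeDegree_inducedSISO_iff R i j (_ + 1)).1
        (by exact_mod_cast hlow i j hj _ hR) _ (Nat.lt_succ_self _)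
    rw [h0 hS, h0 hS']

theorem impulseResponse_rowMin_eq_zero {n : ℕ} {S : StateSpace n m p}
    (hS : S.behavior ∈ explaining (modelClass m p Λ) d)
    (hlow : ∀ (i : Fin p) (j : Fin m), (i, j) ∉ informativePairs (modelClass m p Λ) d →
      ∀ 𝔅' ∈ explaining (modelClass m p Λ) d,
        (rowMin (modelClass m p Λ) d S.behavior i : ℕ∞) + 1 ≤ relativeDegree (inducedSISO 𝔅' i j))
    {i : Fin p} {j : Fin m} (hij : ¬ ((i, j) ∈ informativePairs (modelClass m p Λ) d ∧
      relativeDegree (inducedSISO S.behavior i j) =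
        (rowMin (modelClass m p Λ) d S.behavior i : ℕ∞))) :
    S.impulseResponse (rowMin (modelClass m p Λ) d S.behavior i) i j = 0 := by
  have hle : (rowMin (modelClass m p Λ) d S.behavior i : ℕ∞) + 1 ≤
      relativeDegree (inducedSISO S.behavior i j) := by
    by_cases hj : (i, j) ∈ informativePairs (modelClass m p Λ) d
    · exact Order.add_one_le_of_lt
        (lt_of_le_of_ne (rowMin_le_relativeDegree hS hj) fun h => hij ⟨hj, h.symm⟩)
    · exact hlow i j hj _ hS
  exact (natCast_le_relativeDegree_inducedSISO_iff S i j (_ + 1)).1 (by exact_mod_cast hle) _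
    (Nat.lt_succ_self _)

/-- The matrix built from the data is the decoupling matrix. -/
theorem isIdentifiedMatrix_iff_eq_decouplingMatrix {n : ℕ} {S : StateSpace n m p}
    (hS : S.behavior ∈ explaining (modelClass m p Λ) d)
    (hlow : ∀ (i : Fin p) (j : Fin m), (i, j) ∉ informativePairs (modelClass m p Λ) d →
      ∀ 𝔅' ∈ explaining (modelClass m p Λ) d,
        (rowMin (modelClass m p Λ) d S.behavior i : ℕ∞) + 1 ≤ relativeDegree (inducedSISO 𝔅' i j))
    (G : Matrix (Fin p) (Fin m) ℝ) :
    IsIdentifiedMatrix (modelClass m p Λ) d S.behavior G ↔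
      G = S.decouplingMatrix (rowMin (modelClass m p Λ) d S.behavior) := by
  constructor
  · intro hG
    ext i j
    rw [S.decouplingMatrix_apply]
    by_cases hij : (i, j) ∈ informativePairs (modelClass m p Λ) d ∧
      relativeDegree (inducedSISO S.behavior i j) =
        (rowMin (modelClass m p Λ) d S.behavior i : ℕ∞)
    · obtain ⟨k, hk, hkG, hne⟩ :=
        (hasLeadingValue_inducedSISO_iff S i j _).1 (((hG i j).1 hij) hS).2
      have hr := (relativeDegree_inducedSISO_eq_iff S i j k).2 ⟨hk, hkG ▸ hne⟩
      rw [hij.2, Nat.cast_inj] at hr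
      rw [hr, hkG]
    · rw [(hG i j).2 hij, impulseResponse_rowMin_eq_zero hS hlow hij]
  · rintro rfl i j
    refine ⟨fun hij 𝔅' h𝔅' => ⟨h𝔅'.1, ?_⟩, fun hij => ?_⟩
    · obtain ⟨-, n', S', rfl⟩ := id h𝔅'.1.1
      have hr := (relativeDegree_eq_of_mem_informativePairs hS h𝔅' hij.1).trans hij.2
      rw [relativeDegree_inducedSISO_eq_iff] at hr
      rw [← decouplingMatrix_rowMin_eq hS hlow h𝔅', S'.decouplingMatrix_apply,
        hasLeadingValue_inducedSISO_iff]
      exact ⟨_, hr.1, rfl, hr.2⟩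
    · rw [S.decouplingMatrix_apply, impulseResponse_rowMin_eq_zero hS hlow hij]

/-- The only candidate for the vector relative degree is the vector of the row minima. -/
theorem HasVectorRelativeDegree.eq_rowMin {n : ℕ} {S : StateSpace n m p}
    (hS : S.behavior ∈ explaining (modelClass m p Λ) d)
    (hlow : ∀ (i : Fin p) (j : Fin m), (i, j) ∉ informativePairs (modelClass m p Λ) d →
      ∀ 𝔅' ∈ explaining (modelClass m p Λ) d,
        (rowMin (modelClass m p Λ) d S.behavior i : ℕ∞) + 1 ≤ relativeDegree (inducedSISO 𝔅' i j))
    (hrow : ∀ i : Fin p, ∃ j : Fin m, (i, j) ∈ informativePairs (modelClass m p Λ) d)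
    {s : Fin p → ℕ} (hs : HasVectorRelativeDegree S.behavior s) :
    s = rowMin (modelClass m p Λ) d S.behavior ∧ (S.decouplingMatrix s).rank = p := by
  obtain ⟨n₁, S₁, hS₁, hzero, hrank⟩ := hs
  have himp := StateSpace.impulseResponse_eq_of_behavior_eq hS₁
  have hdec : S₁.decouplingMatrix s = S.decouplingMatrix s := by
    ext i j
    rw [S₁.decouplingMatrix_apply, S.decouplingMatrix_apply, himp]
  rw [hdec] at hrank
  refine ⟨funext fun i => le_antisymm ?_ ?_, hrank⟩
  -- If `s i` exceeded the row minimum, the nonzero leading value at a minimizing pair would have to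
  -- vanish.
  · by_contra! hlt
    obtain ⟨j, -, hr⟩ := exists_relativeDegree_eq_rowMin hS (hrow i)
    refine ((relativeDegree_inducedSISO_eq_iff S i j _).1 hr).2 ?_
    rw [← himp]
    generalize rowMin (modelClass m p Λ) d S.behavior i = k at hlt
    cases k with
    | zero => exact congrFun ((hzero i).2 hlt) j
    | succ k => exact congrFun ((hzero i).1 k hlt) j
  -- If `s i` were below the row minimum, row `i` of the full-rank matrix would be zero.
  · by_contra! hlt
    refine row_ne_zero_of_rank_eq hrank i (funext fun j => ?_)
    rw [S.decouplingMatrix_apply]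
    exact (natCast_le_relativeDegree_inducedSISO_iff S i j _).1
      (rowMin_le_relativeDegree_of_mem_explaining hS hlow hS i j) _ hlt

end DataInformativity

theorem mainTheorem8 {m p T : ℕ} (Λ : Set ℕ)
    (𝔅 : DataInformativity.Behavior m p)
    (h𝔅 : 𝔅 ∈ DataInformativity.modelClass m p Λ)
    (d : Fin (T + 1) → DataInformativity.Signal m p)
    (hd : DataInformativity.Explains 𝔅 d)
    (hrow : ∀ i : Fin p, ∃ j : Fin m,
      (i, j) ∈ DataInformativity.informativePairs (DataInformativity.modelClass m p Λ) d)
    (hlow : ∀ (i : Fin p) (j : Fin m),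
      (i, j) ∉ DataInformativity.informativePairs (DataInformativity.modelClass m p Λ) d →
      ∀ 𝔅' ∈ DataInformativity.explaining (DataInformativity.modelClass m p Λ) d,
        (DataInformativity.rowMin (DataInformativity.modelClass m p Λ) d 𝔅 i : ℕ∞) + 1 ≤
          DataInformativity.relativeDegree (DataInformativity.inducedSISO 𝔅' i j)) :
    (∃! G : Matrix (Fin p) (Fin m) ℝ,
      DataInformativity.IsIdentifiedMatrix (DataInformativity.modelClass m p Λ) d 𝔅 G) ∧
    (∀ G : Matrix (Fin p) (Fin m) ℝ,
      DataInformativity.IsIdentifiedMatrix (DataInformativity.modelClass m p Λ) d 𝔅 G →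
      DataInformativity.Informative (DataInformativity.modelClass m p Λ) d
        fun 𝔅' => DataInformativity.HasDecouplingMatrix 𝔅' G) ∧
    ((∃ s : Fin p → ℕ, DataInformativity.HasVectorRelativeDegree 𝔅 s) →
      DataInformativity.Informative (DataInformativity.modelClass m p Λ) d
        fun 𝔅' => DataInformativity.HasVectorRelativeDegree 𝔅'
          (DataInformativity.rowMin (DataInformativity.modelClass m p Λ) d 𝔅)) := by
  obtain ⟨-, n, S, rfl⟩ := id h𝔅.1
  have hS : S.behavior ∈ DataInformativity.explaining (DataInformativity.modelClass m p Λ) d :=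
    ⟨h𝔅, hd⟩
  have hG := DataInformativity.isIdentifiedMatrix_iff_eq_decouplingMatrix hS hlow
  refine ⟨⟨_, (hG _).2 rfl, fun G h => (hG G).1 h⟩, ?_, ?_⟩
  · rintro G h 𝔅' h𝔅'
    obtain ⟨-, n', S', rfl⟩ := id h𝔅'.1.1
    refine ⟨h𝔅'.1, n', S', rfl, _,
      DataInformativity.rowMin_eq_iInf_relativeDegree hS hlow hrow h𝔅', ?_⟩
    rw [(hG G).1 h, DataInformativity.decouplingMatrix_rowMin_eq hS hlow h𝔅']
  · rintro ⟨s, hs⟩ 𝔅' h𝔅'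
    obtain ⟨-, n', S', rfl⟩ := id h𝔅'.1.1
    obtain ⟨rfl, hrank⟩ := hs.eq_rowMin hS hlow hrow
    have hzero : ∀ i, ∀ k < DataInformativity.rowMin (DataInformativity.modelClass m p Λ) d S.behavior i,
        S'.impulseResponse k i = 0 := fun i k hk => funext fun j =>
      (DataInformativity.natCast_le_relativeDegree_inducedSISO_iff S' i j _).1
        (DataInformativity.rowMin_le_relativeDegree_of_mem_explaining hS hlow h𝔅' i j) k hk
    -- `C_i A ^ k B` has impulse response index `k + 1`, so `k + 2 ≤ r_i` is exactly `k + 1 < r_i`.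
    refine ⟨h𝔅'.1, n', S', rfl, fun i => ⟨fun k hk => hzero i (k + 1) hk, hzero i 0⟩, ?_⟩
    rw [DataInformativity.decouplingMatrix_rowMin_eq hS hlow h𝔅', hrank]
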